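/- Let $(M,\omega,\theta)$ be an exact symplectic manifold of dimension $2n$: $M$ is a smooth manifold, $\omega$ is a closed nondegenerate $2$-form on $M$, and $\theta$ is a $1$-form with $\omega=-d\theta$. Let $c\in\mathbb{R}$, let $F:M\to\mathbb{R}$ be a $C^\infty$ function, and let $X=X_F^c$ be a conformally Hamiltonian vector field with parameter $c$ and conformal Hamiltonian $F$, that is, $i_{X}\omega+c\,\theta=dF$. For $t\in\mathbb{R}$ let $\phi_t$ be the time-$t$ map of the flow of $X$, defined on the set $D_t\subseteq M$ of the points $x$ for which the integral curve of $X$ starting at $x$ is defined at time $t$ (so $D_t=M$ for every $t$ if $X$ is complete). Then for every $t$ the set $D_t$ is open, $\phi_t:D_t\to M$ is $C^\infty$, and $$\phi_t^*\omega=e^{ct}\,\omega\quad\text{on } D_t,$$ so $\phi_t$ is conformally symplectic with parameter $e^{ct}>0$. Moreover, the Liouville volume $\Lambda=\frac{(-1)^{\lfloor n/2\rfloor}}{n!}\,\omega\wedge\cdots\wedge\omega$ ($n$ factors) satisfies $$\phi_t^*\Lambda=e^{nct}\,\Lambda\quad\text{on } D_t.$$ -/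

import Mathlib

open scoped Manifold ContDiff Topology

noncomputable section

namespace ConfSympl

section Wedge

variable {V : Type*} [AddCommGroup V] [Module ℝ V] [TopologicalSpace V]

/-- The tensor product `(v₁, …, v_{k+l}) ↦ a (v₁, …, v_k) * b (v_{k+1}, …, v_{k+l})`. -/
def tensor {k l : ℕ} (a : V [⋀^Fin k]→L[ℝ] ℝ) (b : V [⋀^Fin l]→L[ℝ] ℝ) :
    ContinuousMultilinearMap ℝ (fun _ : Fin (k + l) => V) ℝ where
  toMultilinearMap :=
    (LinearMap.mul' ℝ ℝ).compMultilinearMap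
      ((MultilinearMap.domCoprod a.toMultilinearMap b.toMultilinearMap).domDomCongr finSumFinEquiv)
  cont := by
    have ha : Continuous fun v : Fin (k + l) → V => a fun i => v (Fin.castAdd l i) :=
      a.cont.comp (by fun_prop)
    have hb : Continuous fun v : Fin (k + l) → V => b fun i => v (Fin.natAdd k i) :=
      b.cont.comp (by fun_prop)
    exact (ha.mul hb).congr fun v => by simp

theorem tensor_apply {k l : ℕ} (a : V [⋀^Fin k]→L[ℝ] ℝ) (b : V [⋀^Fin l]→L[ℝ] ℝ)
    (v : Fin (k + l) → V) :
    tensor a b v = a (fun i => v (Fin.castAdd l i)) * b (fun i => v (Fin.natAdd k i)) := by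
  change (LinearMap.mul' ℝ ℝ).compMultilinearMap
    ((MultilinearMap.domCoprod a.toMultilinearMap b.toMultilinearMap).domDomCongr
      finSumFinEquiv) v = _
  simp

/-- The wedge product, with the normalisation
`(a ∧ b)(v) = 1 / (k! l!) * ∑ σ, sign σ * a (v_{σ 1}, …, v_{σ k}) * b (v_{σ (k+1)}, …)`. -/
def wedge {k l : ℕ} (a : V [⋀^Fin k]→L[ℝ] ℝ) (b : V [⋀^Fin l]→L[ℝ] ℝ) :
    V [⋀^Fin (k + l)]→L[ℝ] ℝ :=
  ((k.factorial : ℝ) * (l.factorial : ℝ))⁻¹ • (tensor a b).alternatization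

/-- `wedgePow a k = a ∧ ⋯ ∧ a` (`k` times) for a 2-covector `a`. -/
def wedgePow (a : V [⋀^Fin 2]→L[ℝ] ℝ) : (k : ℕ) → V [⋀^Fin (2 * k)]→L[ℝ] ℝ
  | 0 => ContinuousAlternatingMap.constOfIsEmpty ℝ V (Fin 0) 1
  | k + 1 => wedge (wedgePow a k) a

end Wedge

section Manifold

variable {E : Type*} [NormedAddCommGroup E] [NormedSpace ℝ E]
  {M : Type*} [TopologicalSpace M] [ChartedSpace E M]

variable (E M) in
/-- Differential `k`-forms on `M`, with no regularity imposed. -/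
abbrev Form (k : ℕ) : Type _ := (x : M) → TangentSpace 𝓘(ℝ, E) x [⋀^Fin k]→L[ℝ] ℝ

variable (E M) in
/-- Vector fields on `M`, with no regularity imposed. -/
abbrev VField : Type _ := (x : M) → TangentSpace 𝓘(ℝ, E) x

/-- The pullback `f^* α`, `(f^* α)_x (v₁, …, v_k) = α_{f x} (Df_x v₁, …, Df_x v_k)`. -/
def pullback {k : ℕ} (f : M → M) (α : Form E M k) : Form E M k := fun x =>
  (α (f x)).compContinuousLinearMap (mfderiv 𝓘(ℝ, E) 𝓘(ℝ, E) f x)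

/-- The expression of a form in the chart at `x₀`, i.e. its pullback by the inverse of the chart. -/
def chartRep {k : ℕ} (α : Form E M k) (x₀ : M) : E → E [⋀^Fin k]→L[ℝ] ℝ := fun y =>
  (α ((extChartAt 𝓘(ℝ, E) x₀).symm y)).compContinuousLinearMap
    (mfderiv 𝓘(ℝ, E) 𝓘(ℝ, E) (extChartAt 𝓘(ℝ, E) x₀).symm y)

/-- A form is smooth if its expression in every chart is `C^∞`. -/
def IsSmoothForm {k : ℕ} (α : Form E M k) : Prop :=
  ∀ x₀ : M, ContDiffOn ℝ ∞ (chartRep α x₀) (extChartAt 𝓘(ℝ, E) x₀).target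

/-- The exterior derivative: at `x`, the exterior derivative of the expression of the form in
the chart at `x`, pulled back to `M` by the chart. -/
def extD {k : ℕ} (α : Form E M k) : Form E M (k + 1) := fun x =>
  (extDeriv (chartRep α x) (extChartAt 𝓘(ℝ, E) x x)).compContinuousLinearMap
    (mfderiv 𝓘(ℝ, E) 𝓘(ℝ, E) (extChartAt 𝓘(ℝ, E) x) x)

/-- `Ω` is a symplectic form: a smooth, closed, nondegenerate 2-form. -/
structure IsSymplectic (Ω : Form E M 2) : Prop where
  smooth : IsSmoothForm Ω
  closed : extD Ω = 0
  nondegenerate : ∀ (x : M) (v : TangentSpace 𝓘(ℝ, E) x),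
    (∀ w : TangentSpace 𝓘(ℝ, E) x, Ω x ![v, w] = 0) → v = 0

/-- `(M, Ω, θ)` is an exact symplectic manifold: `Ω` is symplectic and `Ω = -dθ`. -/
structure IsExactSymplectic (Ω : Form E M 2) (θ : Form E M 1) : Prop where
  symplectic : IsSymplectic Ω
  smooth_primitive : IsSmoothForm θ
  eq_neg_extD : Ω = -extD θ

/-- `X` is a conformally Hamiltonian vector field with parameter `c` and conformal Hamiltonian `F`:
`X` and `F` are `C^∞` and `i_X Ω + c θ = dF`. -/
structure IsConformallyHamiltonian [IsManifold 𝓘(ℝ, E) ∞ M] (Ω : Form E M 2) (θ : Form E M 1)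
    (c : ℝ) (F : M → ℝ) (X : VField E M) : Prop where
  smooth_hamiltonian : ContMDiff 𝓘(ℝ, E) 𝓘(ℝ, ℝ) ∞ F
  smooth_field : ContMDiff 𝓘(ℝ, E) 𝓘(ℝ, E).tangent ∞
    (fun x => (⟨x, X x⟩ : TangentBundle 𝓘(ℝ, E) M))
  equation : ∀ (x : M) (v : TangentSpace 𝓘(ℝ, E) x),
    Ω x ![X x, v] + c * θ x ![v] = mfderiv 𝓘(ℝ, E) 𝓘(ℝ, ℝ) F x v

/-- Some integral curve of `X` on an open interval containing `0` starts at `x` and is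
defined at time `t`. -/
def FlowDefinedAt (X : VField E M) (t : ℝ) (x : M) : Prop :=
  ∃ (γ : ℝ → M) (a b : ℝ), 0 ∈ Set.Ioo a b ∧ t ∈ Set.Ioo a b ∧ γ 0 = x ∧
    IsMIntegralCurveOn γ X (Set.Ioo a b)

/-- The domain of the time-`t` map of the (maximal) flow of `X`. -/
def flowDomain (X : VField E M) (t : ℝ) : Set M := {x | FlowDefinedAt X t x}

open Classical in
/-- The time-`t` map `φ_t` of the flow of `X`: the value at time `t` of the integral curve
of `X` starting at `x`. Outside of `flowDomain X t` the value is irrelevant. -/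
def flow (X : VField E M) (t : ℝ) (x : M) : M :=
  if h : FlowDefinedAt X t x then h.choose t else x

/-- `f` is conformally symplectic with parameter `r` as a map from the open submanifold `U`
of `(M, Ω)` to `(M, Ω)`: it is `C^∞`, `r > 0`, and `f^* Ω = r Ω` on `U`. -/
structure IsConformallySymplecticOn (Ω : Form E M 2) (f : M → M) (U : Set M) (r : ℝ) : Prop where
  isOpen : IsOpen U
  smooth : ContMDiffOn 𝓘(ℝ, E) 𝓘(ℝ, E) ∞ f U
  pos : 0 < r
  pullback_eq : ∀ x ∈ U, pullback f Ω x = r • Ω x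

/-- The Liouville volume `Λ = (-1)^⌊n/2⌋ / n! • Ω ∧ ⋯ ∧ Ω` (`n` times). -/
def liouvilleVolume (n : ℕ) (Ω : Form E M 2) : Form E M (2 * n) := fun x =>
  ((-1 : ℝ) ^ (n / 2) / (n.factorial : ℝ)) • wedgePow (Ω x) n

end Manifold

end ConfSympl

end

/-! Cartan's formula gives `L_X Ω = d(i_X Ω) + i_X dΩ = d(dF - cθ) = cΩ`. Hence `φ_s^* Ω` solves the
linear equation `y' = c y` in `s`, and `φ_s^* Ω = e^{cs} Ω`. Pullback commutes with wedge products,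
so `Λ`, a constant multiple of the `n`-th power of `Ω`, is multiplied by `(e^{ct})^n`.

Differentiating `φ_s^* Ω` requires a local flow that is jointly smooth in time and initial point
(`exists_contDiffOn_localFlow`). It comes from the inverse function theorem in the Banach space of
curves `C([0,1], E)`, applied to the integral equation. The Lie derivative computation is done in a
chart (`lieDeriv_eq_of_conformallyHamiltonian`, `compContinuousLinearMap_localFlow`) and carried to
`M` by `exists_localFlow`.

For an arbitrary time `t`, the property "`φ_s` is defined, smooth and conformal near `x`" is locally
constant in `s` along the integral curve of `x`, because `φ_{s+r}` is locally a short-time flow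
composed with `φ_s`. It holds at `s = 0`, so it holds at `t` by connectedness of the interval. -/

noncomputable section

namespace ConfSympl

/-! ### Smoothness of the operator `u ↦ f ∘ u` on continuous functions. -/

section Superposition

universe u

/-- Pointwise evaluation of a continuous family of operators on a continuous family of vectors. -/
def pointwiseApply (K : Type*) [TopologicalSpace K] [CompactSpace K]
    (E F : Type*) [NormedAddCommGroup E] [NormedSpace ℝ E]
    [NormedAddCommGroup F] [NormedSpace ℝ F] :
    C(K, E →L[ℝ] F) →L[ℝ] C(K, E) →L[ℝ] C(K, F) :=
  LinearMap.mkContinuous₂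
    (LinearMap.mk₂ ℝ (fun (A : C(K, E →L[ℝ] F)) (u : C(K, E)) => (⟨fun t => A t (u t), by fun_prop⟩ : C(K, F)))
      (fun _ _ _ => by ext; simp) (fun _ _ _ => by ext; simp)
      (fun _ _ _ => by ext; simp) (fun _ _ _ => by ext; simp)) 1
    (fun A u => by
      rw [one_mul]
      refine (ContinuousMap.norm_le _ (by positivity)).2 fun t => ?_
      exact ((A t).le_opNorm (u t)).trans
        (mul_le_mul (A.norm_coe_le_norm t) (u.norm_coe_le_norm t) (by positivity)
          (by positivity)))

variable {K : Type*} [TopologicalSpace K] [CompactSpace K]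

/-- The superposition operator `u ↦ f ∘ u` on continuous functions. -/
def superposition (K : Type*) [TopologicalSpace K] {E F : Type*} [TopologicalSpace E]
    [TopologicalSpace F] (f : C(E, F)) (u : C(K, E)) : C(K, F) := f.comp u

/-- The mean value inequality with a Lipschitz derivative bounds the remainder at each point by `C
‖v - u‖²`, uniformly in the point, so the bound passes to the sup norm. -/
theorem hasFDerivAt_superposition {E F : Type*} [NormedAddCommGroup E] [NormedSpace ℝ E]
    [NormedAddCommGroup F] [NormedSpace ℝ F] (f : C(E, F)) (f' : C(E, E →L[ℝ] F))
    (hf : ∀ x, HasFDerivAt f (f' x) x) {C : NNReal} (hC : LipschitzWith C f') (u : C(K, E)) :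
    HasFDerivAt (superposition K f) (pointwiseApply K E F (superposition K f' u)) u := by
  have key : ∀ v : C(K, E), ‖superposition K f v - superposition K f u -
      pointwiseApply K E F (superposition K f' u) (v - u)‖ ≤ C * ‖v - u‖ ^ 2 := by
    intro v
    refine (ContinuousMap.norm_le _ (by positivity)).2 fun t => ?_
    have h1 : ‖v t - u t‖ ≤ ‖v - u‖ := (v - u).norm_coe_le_norm t
    have h2 := (convex_closedBall (u t) ‖v - u‖).norm_image_sub_le_of_norm_hasFDerivWithin_le'
      (f := f) (f' := f') (φ := f' (u t)) (C := C * ‖v - u‖) (x := u t) (y := v t)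
      (fun x _ => (hf x).hasFDerivWithinAt)
      (fun x hx => by
        rw [← dist_eq_norm]
        exact (hC.dist_le_mul x (u t)).trans (by gcongr; exact hx))
      (by simp) (by rwa [mem_closedBall_iff_norm])
    change ‖f (v t) - f (u t) - f' (u t) (v t - u t)‖ ≤ _
    calc _ ≤ C * ‖v - u‖ * ‖v t - u t‖ := h2
      _ ≤ C * ‖v - u‖ * ‖v - u‖ := by gcongr
      _ = _ := by ring
  refine .of_isLittleO ?_
  have h1 : (fun v => superposition K f v - superposition K f u -
      pointwiseApply K E F (superposition K f' u) (v - u)) =O[𝓝 u] fun v => ‖v - u‖ ^ 2 :=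
    .of_bound C (.of_forall fun v => by simpa using key v)
  refine h1.trans_isLittleO ?_
  have h2 := (Asymptotics.isLittleO_pow_id (𝕜 := ℝ) (n := 2) one_lt_two)
  have h3 : Filter.Tendsto (fun v : C(K, E) => ‖v - u‖) (𝓝 u) (𝓝 0) := by
    have : Continuous fun v : C(K, E) => ‖v - u‖ := by fun_prop
    simpa using this.tendsto u
  exact (h2.comp_tendsto h3).trans_isBigO (Asymptotics.isBigO_refl _ _).norm_left

/-- The derivative is superposition by `fderiv ℝ f` followed by a bounded linear map, which gives
induction on the order. Compact support makes each derivative Lipschitz. The step replaces `F` by `E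
→L[ℝ] F`, hence the quantifier over `F` and the common universe. -/
theorem contDiff_superposition_nat {E : Type u} [NormedAddCommGroup E] [NormedSpace ℝ E] (n : ℕ) :
    ∀ {F : Type u} [NormedAddCommGroup F] [NormedSpace ℝ F] (f : C(E, F)),
      ContDiff ℝ ∞ f → HasCompactSupport f → ContDiff ℝ n (superposition K f) := by
  induction n with
  | zero =>
    intro F _ _ f hf hs
    exact contDiff_zero.2 (ContinuousMap.continuous_postcomp f)
  | succ n ih =>
    intro F _ _ f hf hs
    let f' : C(E, E →L[ℝ] F) := ⟨fderiv ℝ f, hf.continuous_fderiv (by simp)⟩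
    have hf' : ContDiff ℝ ∞ f' := hf.fderiv_right (by simp)
    have hs' : HasCompactSupport f' := hs.fderiv ℝ
    obtain ⟨C, hC⟩ := hf'.lipschitzWith_of_hasCompactSupport hs' (by simp)
    have hd := hasFDerivAt_superposition (K := K) f f'
      (fun x => (hf.differentiable (by simp) x).hasFDerivAt) hC
    push_cast
    refine contDiff_succ_iff_hasFDerivAt.2 ⟨_, ?_, hd⟩
    exact (pointwiseApply K E F).contDiff.comp (ih f' hf' hs')

theorem contDiff_superposition {E F : Type u} [NormedAddCommGroup E] [NormedSpace ℝ E]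
    [NormedAddCommGroup F] [NormedSpace ℝ F] (f : C(E, F)) (hf : ContDiff ℝ ∞ f)
    (hs : HasCompactSupport f) : ContDiff ℝ ∞ (superposition K f) :=
  contDiff_infty.2 fun n => contDiff_superposition_nat n f hf hs

end Superposition

/-! ### Integration as a bounded operator on curves. -/

section Primitive

variable {E : Type*} [NormedAddCommGroup E] [NormedSpace ℝ E] [CompleteSpace E]

/-- The primitive vanishing at `0` of a continuous function on `[0, 1]`. -/
def primitive (E : Type*) [NormedAddCommGroup E] [NormedSpace ℝ E] [CompleteSpace E] :
    C(Set.Icc (0 : ℝ) 1, E) →L[ℝ] C(Set.Icc (0 : ℝ) 1, E) :=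
  LinearMap.mkContinuous
    { toFun := fun u => ⟨fun τ => ∫ σ in (0 : ℝ)..τ, u (Set.projIcc 0 1 zero_le_one σ), by
        have h : Continuous fun b : ℝ => ∫ σ in (0 : ℝ)..b, u (Set.projIcc 0 1 zero_le_one σ) :=
          intervalIntegral.continuous_primitive
            (fun a b => (u.continuous.comp continuous_projIcc).intervalIntegrable a b) 0
        exact h.comp continuous_subtype_val⟩
      map_add' := fun u v => by
        ext τ
        exact intervalIntegral.integral_add
          ((u.continuous.comp continuous_projIcc).intervalIntegrable _ _)
          ((v.continuous.comp continuous_projIcc).intervalIntegrable _ _)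
      map_smul' := fun c u => by
        ext τ
        exact intervalIntegral.integral_smul c _ } 1
    (fun u => by
      rw [one_mul]
      refine (ContinuousMap.norm_le _ (norm_nonneg _)).2 fun τ => ?_
      refine (intervalIntegral.norm_integral_le_of_norm_le_const
        fun σ _ => u.norm_coe_le_norm _).trans ?_
      rw [sub_zero, abs_of_nonneg τ.2.1]
      exact mul_le_of_le_one_right (norm_nonneg _) τ.2.2)

end Primitive

/-! ### Joint smoothness of local flows in a vector space. -/

section LocalFlow

variable {E : Type*} [NormedAddCommGroup E] [NormedSpace ℝ E]

/-- Multiplication by a bump function; it supplies the compact support that the superposition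
operator needs, without changing the field near `x₀`. -/
theorem exists_contDiff_hasCompactSupport_eqOn [FiniteDimensional ℝ E] {U : Set E} (hU : IsOpen U) {f : E → E}
    (hf : ContDiffOn ℝ ∞ f U) {x₀ : E} (hx₀ : x₀ ∈ U) :
    ∃ g : E → E, ContDiff ℝ ∞ g ∧ HasCompactSupport g ∧
      ∃ W ⊆ U, IsOpen W ∧ x₀ ∈ W ∧ Set.EqOn g f W := by
  obtain ⟨r, hr, hrU⟩ := Metric.isOpen_iff.1 hU x₀ hx₀
  let b : ContDiffBump x₀ := ⟨r / 4, r / 2, by positivity, by linarith⟩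
  have hb : tsupport b ⊆ U := by
    rw [b.tsupport_eq]
    exact (Metric.closedBall_subset_ball (by change r / 2 < r; linarith)).trans hrU
  refine ⟨fun x => b x • f x, contDiff_iff_contDiffAt.2 fun x => ?_,
    b.hasCompactSupport.smul_right, Metric.ball x₀ (r / 4),
    (Metric.ball_subset_ball (by linarith)).trans hrU, Metric.isOpen_ball,
    Metric.mem_ball_self (by positivity), fun x hx => ?_⟩
  · by_cases hx : x ∈ tsupport b
    · exact b.contDiffAt.smul (hf.contDiffAt (hU.mem_nhds (hb hx)))
    · refine (contDiffAt_const (c := (0 : E))).congr_of_eventuallyEq ?_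
      filter_upwards [notMem_tsupport_iff_eventuallyEq.1 hx] with y hy
      simp [hy]
  · have : b x = 1 := b.one_of_mem_closedBall (Metric.ball_subset_closedBall hx)
    simp [this]

/-- Constant functions, as a continuous linear map. -/
def constL (E : Type*) [NormedAddCommGroup E] [NormedSpace ℝ E] :
    E →L[ℝ] C(Set.Icc (0 : ℝ) 1, E) :=
  LinearMap.mkContinuous
    { toFun := fun x => ContinuousMap.const _ x
      map_add' := fun _ _ => rfl
      map_smul' := fun _ _ => rfl } 1
    (fun x => by
      rw [one_mul]
      exact (ContinuousMap.norm_le _ (norm_nonneg _)).2 fun _ => le_rfl)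

variable [FiniteDimensional ℝ E]

/-- The map `((s, x), u) ↦ ((s, x), u - x - s ∫ g ∘ u)`, whose zeros in the second component are
the solutions of `u' = s g(u)`, `u(0) = x` on `[0, 1]`. -/
def integralEquation (g : C(E, E)) (p : (ℝ × E) × C(Set.Icc (0 : ℝ) 1, E)) :
    (ℝ × E) × C(Set.Icc (0 : ℝ) 1, E) :=
  (p.1, p.2 - constL E p.1.2 - p.1.1 • primitive E (superposition _ g p.2))

theorem contDiff_integralEquation (g : C(E, E)) (hg : ContDiff ℝ ∞ g) (hs : HasCompactSupport g) :
    ContDiff ℝ ∞ (integralEquation g) := by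
  refine contDiff_fst.prodMk ((contDiff_snd.sub ?_).sub ?_)
  · exact (constL E).contDiff.comp (contDiff_snd.comp contDiff_fst)
  · exact (contDiff_fst.comp contDiff_fst).smul
      ((primitive E).contDiff.comp ((contDiff_superposition g hg hs).comp contDiff_snd))

/-- At `s = 0` the integral term has no derivative in the direction of `u`, so the derivative is
triangular with identity diagonal blocks. -/
theorem exists_equiv_hasFDerivAt_integralEquation (g : C(E, E)) (hg : ContDiff ℝ ∞ g)
    (hs : HasCompactSupport g) (x₀ : E) :
    ∃ e : ((ℝ × E) × C(Set.Icc (0 : ℝ) 1, E)) ≃L[ℝ] ((ℝ × E) × C(Set.Icc (0 : ℝ) 1, E)),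
      HasFDerivAt (integralEquation g) (e : _ →L[ℝ] _) ((0, x₀), constL E x₀) := by
  set p₀ : (ℝ × E) × C(Set.Icc (0 : ℝ) 1, E) := ((0, x₀), constL E x₀)
  have hN : HasFDerivAt
      (fun p : (ℝ × E) × C(Set.Icc (0 : ℝ) 1, E) => primitive E (superposition _ g p.2))
      _ p₀ := (((primitive E).contDiff.comp ((contDiff_superposition g hg hs).comp
        contDiff_snd)).differentiable (by simp : (∞ : WithTop ℕ∞) ≠ 0) p₀).hasFDerivAt
  have h1 : HasFDerivAt (fun p : (ℝ × E) × C(Set.Icc (0 : ℝ) 1, E) => p.1.1)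
      ((ContinuousLinearMap.fst ℝ ℝ E).comp (ContinuousLinearMap.fst ℝ _ _)) p₀ :=
    ((ContinuousLinearMap.fst ℝ ℝ E).comp
      (ContinuousLinearMap.fst ℝ (ℝ × E) C(Set.Icc (0 : ℝ) 1, E))).hasFDerivAt
  have h2 : HasFDerivAt (fun p : (ℝ × E) × C(Set.Icc (0 : ℝ) 1, E) => constL E p.1.2)
      ((constL E).comp ((ContinuousLinearMap.snd ℝ ℝ E).comp (ContinuousLinearMap.fst ℝ _ _))) p₀ :=
    ((constL E).comp ((ContinuousLinearMap.snd ℝ ℝ E).comp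
      (ContinuousLinearMap.fst ℝ (ℝ × E) C(Set.Icc (0 : ℝ) 1, E)))).hasFDerivAt
  have h := (hasFDerivAt_fst (𝕜 := ℝ) (p := p₀)).prodMk
    (((hasFDerivAt_snd (𝕜 := ℝ) (p := p₀)).sub h2).sub (h1.smul hN))
  let A : (ℝ × E) →L[ℝ] C(Set.Icc (0 : ℝ) 1, E) :=
    -((constL E).comp (ContinuousLinearMap.snd ℝ ℝ E)) -
      (ContinuousLinearMap.fst ℝ ℝ E).smulRight (primitive E (superposition _ g (constL E x₀)))
  refine ⟨(ContinuousLinearEquiv.refl ℝ (ℝ × E)).skewProd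
    (ContinuousLinearEquiv.refl ℝ C(Set.Icc (0 : ℝ) 1, E)) A, h.congr_fderiv ?_⟩
  ext <;> simp [A, p₀]

/-- Rescaling time by `s` puts all solutions on the fixed interval `[0, 1]` and turns time into a
parameter; this is what yields smoothness in `s` as well as in `x`. -/
theorem integralEquation_eq_of_hasDerivAt (g : C(E, E)) {β : ℝ → E} {ε s : ℝ}
    (hβ : ∀ t ∈ Set.Ioo (-ε) ε, HasDerivAt β (g (β t)) t) (hs : s ∈ Set.Ioo (-ε) ε) :
    ∃ u : C(Set.Icc (0 : ℝ) 1, E), (∀ τ : Set.Icc (0 : ℝ) 1, u τ = β (s * τ)) ∧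
      integralEquation g ((s, β 0), u) = ((s, β 0), 0) := by
  have hmem : ∀ τ ∈ Set.Icc (0 : ℝ) 1, s * τ ∈ Set.Ioo (-ε) ε := by
    intro τ hτ
    rw [Set.mem_Ioo, ← abs_lt] at hs ⊢
    rw [abs_mul, abs_of_nonneg hτ.1]
    exact (mul_le_of_le_one_right (abs_nonneg _) hτ.2).trans_lt hs
  have hder : ∀ τ ∈ Set.Icc (0 : ℝ) 1,
      HasDerivAt (fun σ => β (s * σ)) (s • g (β (s * τ))) τ := by
    intro τ hτ
    have h1 : HasDerivAt (fun σ : ℝ => s * σ) s τ := by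
      simpa using (hasDerivAt_id τ).const_mul s
    exact HasDerivAt.scomp τ (hβ _ (hmem τ hτ)) h1
  have hcont : ContinuousOn (fun σ => β (s * σ)) (Set.Icc (0 : ℝ) 1) := fun τ hτ =>
    (hder τ hτ).continuousAt.continuousWithinAt
  refine ⟨⟨fun τ => β (s * τ), hcont.comp_continuous continuous_subtype_val fun τ => τ.2⟩,
    fun τ => rfl, Prod.ext rfl ?_⟩
  ext τ
  have hsub : Set.uIcc (0 : ℝ) τ ⊆ Set.Icc 0 1 := by
    rw [Set.uIcc_of_le τ.2.1]
    exact Set.Icc_subset_Icc_right τ.2.2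
  have hFTC := intervalIntegral.integral_eq_sub_of_hasDerivAt (a := (0 : ℝ)) (b := τ)
    (fun σ hσ => hder σ (hsub hσ))
    (((g.continuous.comp_continuousOn (hcont.mono hsub)).const_smul s).intervalIntegrable)
  have hint : ∫ σ in (0 : ℝ)..τ, g (β (s * (Set.projIcc 0 1 zero_le_one σ : Set.Icc (0 : ℝ) 1)))
      = ∫ σ in (0 : ℝ)..τ, g (β (s * σ)) :=
    intervalIntegral.integral_congr fun σ hσ => by
      simp only [Set.projIcc_of_mem _ (hsub hσ)]
  have : β (s * τ) - β 0 - s • ∫ σ in (0 : ℝ)..τ,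
      g (β (s * (Set.projIcc 0 1 zero_le_one σ : Set.Icc (0 : ℝ) 1))) = 0 := by
    rw [hint, ← intervalIntegral.integral_smul, hFTC]
    simp
  exact this

/-- A smooth vector field on an open subset of a finite-dimensional space has a local flow which
is jointly smooth in time and initial point. -/
theorem exists_contDiffOn_localFlow {U : Set E} (hU : IsOpen U) {f : E → E}
    (hf : ContDiffOn ℝ ∞ f U) {x₀ : E} (hx₀ : x₀ ∈ U) :
    ∃ ε > 0, ∃ V : Set E, IsOpen V ∧ x₀ ∈ V ∧ ∃ φ : ℝ × E → E,
      ContDiffOn ℝ ∞ φ (Set.Ioo (-ε) ε ×ˢ V) ∧ (∀ x ∈ V, φ (0, x) = x) ∧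
      ∀ s ∈ Set.Ioo (-ε) ε, ∀ x ∈ V, φ (s, x) ∈ U ∧
        HasDerivAt (fun r => φ (r, x)) (f (φ (s, x))) s := by
  obtain ⟨g, hg, hgs, W, hWU, hW, hxW, hgf⟩ := exists_contDiff_hasCompactSupport_eqOn hU hf hx₀
  obtain ⟨ε, hε, a, r, L, K, hr, hPL⟩ := IsPicardLindelof.of_contDiffAt_one
    (hg.contDiffAt.of_le (by simp) : ContDiffAt ℝ 1 g x₀)
  obtain ⟨α, hα, hαc⟩ := (hPL 0).exists_forall_mem_closedBall_eq_hasDerivWithinAt_continuousOn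
  simp only [zero_sub, zero_add] at hα hαc
  have hαd : ∀ x ∈ Metric.closedBall x₀ r, ∀ t ∈ Set.Ioo (-ε) ε,
      HasDerivAt (fun t => α (x, t)) (g (α (x, t))) t := fun x hx t ht =>
    ((hα x hx).2 t (Set.Ioo_subset_Icc_self ht)).hasDerivAt (Icc_mem_nhds ht.1 ht.2)
  let G : C(E, E) := ⟨g, hg.continuous⟩
  have hG : ContDiff ℝ ∞ (integralEquation G) := contDiff_integralEquation G hg hgs
  obtain ⟨D, hD⟩ := exists_equiv_hasFDerivAt_integralEquation G hg hgs x₀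
  set p₀ : (ℝ × E) × C(Set.Icc (0 : ℝ) 1, E) := ((0, x₀), constL E x₀)
  have hn : (∞ : WithTop ℕ∞) ≠ 0 := by simp
  let e := hG.contDiffAt.toOpenPartialHomeomorph (integralEquation G) hD hn
  -- The local inverse is smooth at images of points with invertible derivative, so invertibility is
  -- needed on a neighbourhood of `p₀`.
  have hO : e.source ∩ fderiv ℝ (integralEquation G) ⁻¹' Set.range
      ((↑) : (((ℝ × E) × C(Set.Icc (0 : ℝ) 1, E)) ≃L[ℝ] ((ℝ × E) × C(Set.Icc (0 : ℝ) 1, E))) →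
        ((ℝ × E) × C(Set.Icc (0 : ℝ) 1, E)) →L[ℝ] ((ℝ × E) × C(Set.Icc (0 : ℝ) 1, E))) ∈ 𝓝 p₀ := by
    refine Filter.inter_mem (e.open_source.mem_nhds
      (hG.contDiffAt.mem_toOpenPartialHomeomorph_source hD hn)) ?_
    refine (hG.continuous_fderiv hn).continuousAt.preimage_mem_nhds ?_
    rw [hD.fderiv]
    exact ContinuousLinearEquiv.nhds D
  obtain ⟨η, hη, hηO⟩ := Metric.mem_nhds_iff.1 hO
  have hc : ContinuousAt α (x₀, 0) := hαc.continuousAt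
    (prod_mem_nhds (Metric.closedBall_mem_nhds _ hr) (Icc_mem_nhds (by linarith) hε))
  have hα0 : α (x₀, 0) = x₀ := (hα x₀ (Metric.mem_closedBall_self r.2)).1
  have hnear := hc.preimage_mem_nhds (t := W ∩ Metric.ball x₀ η) (by
    rw [hα0]; exact Filter.inter_mem (hW.mem_nhds hxW) (Metric.ball_mem_nhds _ hη))
  obtain ⟨δ', hδ', hδn⟩ := Metric.mem_nhds_iff.1 hnear
  -- `ε` and `r` keep times and initial points within the Picard–Lindelöf range; `η` and `δ'` put
  -- the rescaled curve in the `η`-ball where the inverse is controlled, and `δ'` also keeps the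
  -- solution in `W`, where `g = f`.
  obtain ⟨δ, hδ, hδε, hδη, hδr, hδδ⟩ : ∃ δ > 0, δ ≤ ε ∧ δ ≤ η ∧ δ ≤ r ∧ δ ≤ δ' :=
    ⟨min (min ε η) (min r δ'), by have : (0 : ℝ) < r := hr; positivity, by simp, by simp, by simp,
      by simp⟩
  have hin : ∀ s ∈ Set.Ioo (-δ) δ, ∀ x ∈ Metric.ball x₀ δ,
      α (x, s) ∈ W ∩ Metric.ball x₀ η := by
    intro s hs x hx
    refine hδn (?_ : (x, s) ∈ _)
    rw [Metric.mem_ball, Prod.dist_eq]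
    refine max_lt (hx.trans_le hδδ) ?_
    rw [Real.dist_eq, sub_zero]
    exact (abs_lt.2 hs).trans_le hδδ
  have hball : ∀ x ∈ Metric.ball x₀ δ, x ∈ Metric.closedBall x₀ r := fun x hx =>
    (Metric.ball_subset_closedBall hx).trans hδr
  have hIoo : ∀ s ∈ Set.Ioo (-δ) δ, s ∈ Set.Ioo (-ε) ε := fun s hs =>
    ⟨by linarith [hs.1], by linarith [hs.2]⟩
  have hu : ∀ s ∈ Set.Ioo (-δ) δ, ∀ x ∈ Metric.ball x₀ δ,
      ∃ p ∈ Metric.ball p₀ η, integralEquation G p = ((s, x), 0) ∧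
        p.2 ⟨1, by simp⟩ = α (x, s) := by
    intro s hs x hx
    obtain ⟨u, hu, hue⟩ := integralEquation_eq_of_hasDerivAt G (hαd x (hball x hx)) (hIoo s hs)
    rw [(hα x (hball x hx)).1] at hue
    refine ⟨((s, x), u), ?_, hue, by simp [hu]⟩
    rw [Metric.mem_ball, Prod.dist_eq, Prod.dist_eq]
    refine max_lt (max_lt ?_ (hx.trans_le hδη)) ?_
    · rw [Real.dist_eq, sub_zero]
      exact (abs_lt.2 hs).trans_le hδη
    · refine (ContinuousMap.dist_lt_iff hη).2 fun τ => ?_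
      rw [hu τ]
      refine (hin _ ?_ x hx).2
      rw [Set.mem_Ioo, ← abs_lt, abs_mul, abs_of_nonneg τ.2.1]
      exact (mul_le_of_le_one_right (abs_nonneg _) τ.2.2).trans_lt (abs_lt.2 hs)
  refine ⟨δ, hδ, Metric.ball x₀ δ, Metric.isOpen_ball, Metric.mem_ball_self hδ,
    fun q => α (q.2, q.1), ?_, fun x hx => (hα x (hball x hx)).1, fun s hs x hx => ?_⟩
  -- The Picard–Lindelöf flow, so far only continuous, is the value at `1` of the curve returned by
  -- the smooth local inverse.
  · have hφ : Set.EqOn (fun q : ℝ × E => α (q.2, q.1))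
        (fun q => (e.symm (q, 0)).2 ⟨1, by simp⟩) (Set.Ioo (-δ) δ ×ˢ Metric.ball x₀ δ) := by
      rintro ⟨s, x⟩ ⟨hs, hx⟩
      obtain ⟨p, hp, hpe, hp1⟩ := hu s hs x hx
      have : e.symm ((s, x), 0) = p := by
        rw [← hpe]
        exact e.left_inv (hηO hp).1
      simp only [this, hp1]
    refine ContDiffOn.congr ?_ hφ
    rintro ⟨s, x⟩ ⟨hs, hx⟩
    obtain ⟨p, hp, hpe, hp1⟩ := hu s hs x hx
    obtain ⟨hps, D', hD'⟩ := hηO hp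
    have hsym : e.symm ((s, x), 0) = p := by
      rw [← hpe]
      exact e.left_inv hps
    have hsmooth : ContDiffAt ℝ ∞ e.symm ((s, x), 0) := by
      refine e.contDiffAt_symm (f₀' := D') ?_ ?_ ?_
      · rw [← hpe]
        exact e.map_source hps
      · rw [hsym, hD']
        exact (hG.differentiable hn p).hasFDerivAt
      · exact hG.contDiffAt
    refine ContDiffAt.contDiffWithinAt ?_
    have h1 : ContDiffAt ℝ ∞ (fun q : ℝ × E => (e.symm (q, 0)).2) (s, x) :=
      contDiff_snd.contDiffAt.comp (s, x) (hsmooth.comp (s, x)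
        (contDiff_id.prodMk contDiff_const).contDiffAt)
    exact (ContinuousMap.evalCLM ℝ (⟨1, by simp⟩ : Set.Icc (0 : ℝ) 1)).contDiff.contDiffAt.comp
      (s, x) h1
  · have hm := (hin s hs x hx).1
    refine ⟨hWU hm, ?_⟩
    rw [← hgf hm]
    exact hαd x (hball x hx) s (hIoo s hs)

end LocalFlow

/-! ### The Lie derivative of a 2-form and its integration along the flow. -/

section LieDerivative

variable {E : Type*} [NormedAddCommGroup E] [NormedSpace ℝ E]

theorem fderiv_apply_two {G : Type*} [NormedAddCommGroup G] [NormedSpace ℝ G]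
    {A : G → E [⋀^Fin 2]→L[ℝ] ℝ} {u v : G → E} {x : G} (hA : DifferentiableAt ℝ A x)
    (hu : DifferentiableAt ℝ u x) (hv : DifferentiableAt ℝ v x) :
    HasFDerivAt (fun y => A y ![u y, v y]) (fderiv ℝ (fun y => A y ![u y, v y]) x) x ∧
    ∀ d : G, fderiv ℝ (fun y => A y ![u y, v y]) x d =
      fderiv ℝ A x d ![u x, v x] + A x ![fderiv ℝ u x d, v x] + A x ![u x, fderiv ℝ v x d] := by
  have hg : ∀ i, DifferentiableAt ℝ ((![u, v] : Fin 2 → G → E) i) x :=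
    Fin.forall_fin_two.2 ⟨hu, hv⟩
  have he : ∀ y, (fun i => (![u, v] : Fin 2 → G → E) i y) = ![u y, v y] := fun y => by
    ext i; fin_cases i <;> rfl
  have h := hA.continuousAlternatingMap_apply hg
  have h' := fun d => fderiv_continuousAlternatingMap_apply_apply hA hg d
  simp only [he, Fin.sum_univ_two] at h h'
  refine ⟨h.hasFDerivAt, fun d => ?_⟩
  rw [h' d, ← add_assoc]
  congr 3
  · ext i; fin_cases i <;> simp
  · ext i; fin_cases i <;> simp

theorem extDeriv_apply_two (θ : E → E [⋀^Fin 1]→L[ℝ] ℝ) (p a b : E) :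
    extDeriv θ p ![a, b] = fderiv ℝ θ p a ![b] - fderiv ℝ θ p b ![a] := by
  rw [extDeriv, ContinuousAlternatingMap.alternatizeUncurryFin_apply, Fin.sum_univ_two]
  have h0 : (0 : Fin 2).removeNth ![a, b] = ![b] := by
    ext i; fin_cases i; rfl
  have h1 : (1 : Fin 2).removeNth ![a, b] = ![a] := by
    ext i; fin_cases i; rfl
  rw [h0, h1]
  simp [sub_eq_add_neg]

theorem extDeriv_apply_three (η : E → E [⋀^Fin 2]→L[ℝ] ℝ) (p a b d : E) :
    extDeriv η p ![a, b, d] =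
      fderiv ℝ η p a ![b, d] - fderiv ℝ η p b ![a, d] + fderiv ℝ η p d ![a, b] := by
  rw [extDeriv, ContinuousAlternatingMap.alternatizeUncurryFin_apply, Fin.sum_univ_three]
  have h0 : (0 : Fin 3).removeNth ![a, b, d] = ![b, d] := by
    ext i; fin_cases i <;> rfl
  have h1 : (1 : Fin 3).removeNth ![a, b, d] = ![a, d] := by
    ext i; fin_cases i <;> rfl
  have h2 : (2 : Fin 3).removeNth ![a, b, d] = ![a, b] := by
    ext i; fin_cases i <;> rfl
  rw [h0, h1, h2]
  simp [sub_eq_add_neg]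

theorem apply_two_swap (A : E [⋀^Fin 2]→L[ℝ] ℝ) (a b : E) : A ![b, a] = -A ![a, b] := by
  have h : A (![a, b] ∘ Equiv.swap 0 1) = -A ![a, b] := A.map_swap ![a, b] (by decide)
  rw [← h]
  congr 1
  ext i; fin_cases i <;> rfl

/-- The Lie derivative of `η` along a conformally Hamiltonian vector field is `c • η`. -/
theorem lieDeriv_eq_of_conformallyHamiltonian {η : E → E [⋀^Fin 2]→L[ℝ] ℝ}
    {θ : E → E [⋀^Fin 1]→L[ℝ] ℝ} {F : E → ℝ} {f : E → E} {c : ℝ} {p : E}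
    (hη : DifferentiableAt ℝ η p) (hθ : DifferentiableAt ℝ θ p) (hf : DifferentiableAt ℝ f p)
    (hF : ContDiffAt ℝ 2 F p)
    (heq : ∀ᶠ q in 𝓝 p, ∀ w, η q ![f q, w] + c * θ q ![w] = fderiv ℝ F q w)
    (hclosed : extDeriv η p = 0) (hexact : η p = -extDeriv θ p) (a b : E) :
    fderiv ℝ η p (f p) ![a, b] + η p ![fderiv ℝ f p a, b] + η p ![a, fderiv ℝ f p b] =
      c * η p ![a, b] := by
  have hF' : DifferentiableAt ℝ (fderiv ℝ F) p :=
    (hF.fderiv_right (m := 1) (by norm_num)).differentiableAt (by simp)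
  -- The conformal Hamilton equation, paired with a constant vector `w`, differentiated in the
  -- direction `d`.
  have key : ∀ d w : E, fderiv ℝ η p d ![f p, w] + η p ![fderiv ℝ f p d, w] +
      c * fderiv ℝ θ p d ![w] = fderiv ℝ (fderiv ℝ F) p d w := by
    intro d w
    obtain ⟨h1, h1'⟩ := fderiv_apply_two hη hf (differentiableAt_const w)
    have h2 : HasFDerivAt (fun q => θ q ![w]) _ p :=
      hθ.hasFDerivAt.continuousAlternatingMap_apply_const ![w]
    have h3 : HasFDerivAt (fun q => fderiv ℝ F q w) ((fderiv ℝ (fderiv ℝ F) p).flip w) p := by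
      simpa using hF'.hasFDerivAt.clm_apply (hasFDerivAt_const w p)
    have h4 := (h1.add (h2.const_mul c)).unique
      (h3.congr_of_eventuallyEq (heq.mono fun q hq => hq w))
    have h5 := DFunLike.congr_fun h4 d
    simp only [add_apply, smul_apply,
      ContinuousLinearMap.flip_apply, h1'] at h5
    have h6 : η p ![f p, 0] = 0 := (η p).map_coord_zero 1 rfl
    simp [h6] at h5
    linarith
  -- Cartan's formula by hand: in `key a b - key b a` the Hessians of `F` cancel, `dη = 0` turns the
  -- derivatives of `η` into the one along `f p`, and those of `θ` form `dθ = -η`.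
  have hsymm : IsSymmSndFDerivAt ℝ F p := hF.isSymmSndFDerivAt (by simp)
  have h1 := key a b
  have h2 := key b a
  have h3 := hsymm a b
  have h4 := extDeriv_apply_three η p (f p) a b
  have h5 := extDeriv_apply_two θ p a b
  have h6 : η p ![a, b] = -(extDeriv θ p ![a, b]) := by rw [hexact]; rfl
  rw [hclosed] at h4
  rw [apply_two_swap (η p) a] at h2
  change (0 : ℝ) = _ at h4
  rw [h6, h5]
  linarith

/-- Along the flow of `f`, a form whose Lie derivative is `c • η` is multiplied by `e^{cs}`. -/
theorem compContinuousLinearMap_localFlow {U V : Set E} {ε c : ℝ} (hV : IsOpen V)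
    {η : E → E [⋀^Fin 2]→L[ℝ] ℝ} {f : E → E} {φ : ℝ × E → E}
    (hη : ∀ p ∈ U, DifferentiableAt ℝ η p) (hf : ∀ p ∈ U, DifferentiableAt ℝ f p)
    (hL : ∀ p ∈ U, ∀ a b, fderiv ℝ η p (f p) ![a, b] + η p ![fderiv ℝ f p a, b] +
      η p ![a, fderiv ℝ f p b] = c * η p ![a, b])
    (hφ : ContDiffOn ℝ ∞ φ (Set.Ioo (-ε) ε ×ˢ V)) (hφ0 : ∀ x ∈ V, φ (0, x) = x)
    (hφd : ∀ s ∈ Set.Ioo (-ε) ε, ∀ x ∈ V, φ (s, x) ∈ U ∧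
      HasDerivAt (fun r => φ (r, x)) (f (φ (s, x))) s)
    {s : ℝ} (hs : s ∈ Set.Ioo (-ε) ε) {x : E} (hx : x ∈ V) :
    (η (φ (s, x))).compContinuousLinearMap (fderiv ℝ (fun y => φ (s, y)) x) =
      Real.exp (c * s) • η x := by
  have hopen : IsOpen (Set.Ioo (-ε) ε ×ˢ V) := isOpen_Ioo.prod hV
  have hC : ∀ r ∈ Set.Ioo (-ε) ε, ∀ y ∈ V, ContDiffAt ℝ ∞ φ (r, y) := fun r hr y hy =>
    hφ.contDiffAt (hopen.mem_nhds ⟨hr, hy⟩)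
  have hd : ∀ r ∈ Set.Ioo (-ε) ε, ∀ y ∈ V, DifferentiableAt ℝ φ (r, y) := fun r hr y hy =>
    (hC r hr y hy).differentiableAt (by simp)
  have hspace : ∀ r ∈ Set.Ioo (-ε) ε, ∀ v, fderiv ℝ (fun y => φ (r, y)) x v =
      fderiv ℝ φ (r, x) (0, v) := by
    intro r hr v
    have h := (hd r hr x hx).hasFDerivAt.comp x (hasFDerivAt_prodMk_right (𝕜 := ℝ) r x)
    rw [show (fun y => φ (r, y)) = φ ∘ fun y => (r, y) from rfl, h.fderiv]
    simp
  have htime : ∀ r ∈ Set.Ioo (-ε) ε, ∀ y ∈ V, fderiv ℝ φ (r, y) (1, 0) = f (φ (r, y)) := by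
    intro r hr y hy
    have h := (hd r hr y hy).hasFDerivAt.comp_hasDerivAt r
      ((hasDerivAt_id r).prodMk (hasDerivAt_const r y))
    exact h.unique (hφd r hr y hy).2
  -- The variational equation: symmetry of second derivatives exchanges the time and space
  -- derivatives of `φ`, and `htime` is then differentiated in space.
  have hvar : ∀ r ∈ Set.Ioo (-ε) ε, ∀ v, HasDerivAt (fun q => fderiv ℝ φ (q, x) (0, v))
      (fderiv ℝ f (φ (r, x)) (fderiv ℝ φ (r, x) (0, v))) r := by
    intro r hr v
    have hdd : DifferentiableAt ℝ (fderiv ℝ φ) (r, x) :=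
      ((hC r hr x hx).fderiv_right (m := ∞) (by simp)).differentiableAt (by simp)
    have h1 := (hdd.hasFDerivAt.clm_apply (hasFDerivAt_const ((0, v) : ℝ × E) (r, x))).comp_hasDerivAt
      r ((hasDerivAt_id r).prodMk (hasDerivAt_const r x))
    have h2 := hdd.hasFDerivAt.clm_apply (hasFDerivAt_const ((1, 0) : ℝ × E) (r, x))
    have h3 : HasFDerivAt (fun q => f (φ q)) _ (r, x) :=
      (hf _ (hφd r hr x hx).1).hasFDerivAt.comp (r, x) (hd r hr x hx).hasFDerivAt
    have h4 := h2.unique (h3.congr_of_eventuallyEq (by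
      filter_upwards [hopen.mem_nhds ⟨hr, hx⟩] with q hq using htime q.1 hq.1 q.2 hq.2))
    have h5 := DFunLike.congr_fun h4 (0, v)
    have h6 : IsSymmSndFDerivAt ℝ φ (r, x) := (hC r hr x hx).isSymmSndFDerivAt (by
      simpa using WithTop.coe_le_coe.2 (le_top : (2 : ℕ∞) ≤ ⊤))
    have h7 := h6 (1, 0) (0, v)
    refine h1.congr_deriv ?_
    simp at h5 ⊢
    rw [h7, h5]
  have hcurve : ∀ v w, ∀ r ∈ Set.Ioo (-ε) ε,
      HasDerivAt (fun q => η (φ (q, x)) ![fderiv ℝ φ (q, x) (0, v), fderiv ℝ φ (q, x) (0, w)])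
        (c * η (φ (r, x)) ![fderiv ℝ φ (r, x) (0, v), fderiv ℝ φ (r, x) (0, w)]) r := by
    intro v w r hr
    have hη' : HasDerivAt (fun q => η (φ (q, x))) (fderiv ℝ η (φ (r, x)) (f (φ (r, x)))) r :=
      (hη _ (hφd r hr x hx).1).hasFDerivAt.comp_hasDerivAt r (hφd r hr x hx).2
    obtain ⟨h1, h2⟩ := fderiv_apply_two hη'.differentiableAt (hvar r hr v).differentiableAt
      (hvar r hr w).differentiableAt
    refine h1.hasDerivAt.congr_deriv ?_
    rw [h2, ← hL _ (hφd r hr x hx).1]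
    simp only [fderiv_apply_one_eq_deriv, hη'.deriv, (hvar r hr v).deriv, (hvar r hr w).deriv]
  have h0 : (0 : ℝ) ∈ Set.Ioo (-ε) ε := by
    constructor <;> linarith [hs.1, hs.2]
  have hid : ∀ v, fderiv ℝ φ (0, x) (0, v) = v := by
    intro v
    rw [← hspace 0 h0]
    have : (fun y => φ (0, y)) =ᶠ[𝓝 x] id := by
      filter_upwards [hV.mem_nhds hx] with y hy using hφ0 y hy
    rw [this.fderiv_eq, fderiv_id]
    rfl
  ext m
  obtain ⟨v, w, rfl⟩ : ∃ v w, m = ![v, w] := ⟨m 0, m 1, by ext i; fin_cases i <;> rfl⟩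
  -- By `hcurve` the pulled-back form solves `y' = c y`; the integrating factor makes it constant,
  -- and at `r = 0` the flow is the identity.
  have hconst : ∀ r ∈ Set.Ioo (-ε) ε, HasDerivAt (fun q => Real.exp (-(c * q)) *
      η (φ (q, x)) ![fderiv ℝ φ (q, x) (0, v), fderiv ℝ φ (q, x) (0, w)]) 0 r := by
    intro r hr
    have h1 : HasDerivAt (fun q => Real.exp (-(c * q))) (Real.exp (-(c * r)) * -(c * 1)) r :=
      (((hasDerivAt_id r).const_mul c).neg).exp
    refine (h1.mul (hcurve v w r hr)).congr_deriv ?_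
    ring
  have hfin := isOpen_Ioo.is_const_of_deriv_eq_zero isPreconnected_Ioo
    (fun r hr => (hconst r hr).differentiableAt.differentiableWithinAt)
    (fun r hr => (hconst r hr).deriv) hs h0
  simp only [hid, hφ0 x hx, mul_zero, neg_zero, Real.exp_zero, one_mul] at hfin
  have hL : (η (φ (s, x))).compContinuousLinearMap (fderiv ℝ (fun y => φ (s, y)) x) ![v, w] =
      η (φ (s, x)) ![fderiv ℝ φ (s, x) (0, v), fderiv ℝ φ (s, x) (0, w)] := by
    rw [ContinuousAlternatingMap.compContinuousLinearMap_apply]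
    congr 1
    ext i; fin_cases i <;> simp [hspace s hs]
  rw [hL, ContinuousAlternatingMap.smul_apply, ← hfin, smul_eq_mul, ← mul_assoc, ← Real.exp_add]
  simp

end LieDerivative

/-! ### Naturality and homogeneity of wedge powers. -/

section Wedge

variable {V : Type*} [AddCommGroup V] [Module ℝ V] [TopologicalSpace V]

theorem wedge_compContinuousLinearMap {k l : ℕ} (a : V [⋀^Fin k]→L[ℝ] ℝ)
    (b : V [⋀^Fin l]→L[ℝ] ℝ) (T : V →L[ℝ] V) :
    wedge (a.compContinuousLinearMap T) (b.compContinuousLinearMap T) =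
      (wedge a b).compContinuousLinearMap T := by
  ext v
  simp [wedge, ContinuousMultilinearMap.alternatization_apply_apply, tensor_apply,
    Function.comp_def]

theorem wedgePow_compContinuousLinearMap (a : V [⋀^Fin 2]→L[ℝ] ℝ) (T : V →L[ℝ] V) (k : ℕ) :
    wedgePow (a.compContinuousLinearMap T) k = (wedgePow a k).compContinuousLinearMap T := by
  induction k with
  | zero => ext v; rfl
  | succ k ih => rw [wedgePow, ih, wedge_compContinuousLinearMap, wedgePow]

theorem wedge_smul_smul {k l : ℕ} (a : V [⋀^Fin k]→L[ℝ] ℝ) (b : V [⋀^Fin l]→L[ℝ] ℝ) (r s : ℝ) :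
    wedge (r • a) (s • b) = (r * s) • wedge a b := by
  have h : tensor (r • a) (s • b) = (r * s) • tensor a b := by
    ext v
    simp [tensor_apply]
    ring
  ext v
  simp only [wedge, h, ContinuousMultilinearMap.alternatization_apply_apply,
    ContinuousAlternatingMap.smul_apply, smul_apply, smul_eq_mul,
    Finset.mul_sum]
  refine Finset.sum_congr rfl fun σ _ => ?_
  simp only [Units.smul_def, zsmul_eq_mul]
  ring

theorem wedgePow_smul (a : V [⋀^Fin 2]→L[ℝ] ℝ) (r : ℝ) (k : ℕ) :
    wedgePow (r • a) k = r ^ k • wedgePow a k := by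
  induction k with
  | zero => simp [wedgePow]
  | succ k ih => rw [wedgePow, ih, wedge_smul_smul, wedgePow, pow_succ]

end Wedge

/-! ### Forms and vector fields in charts. -/

section Charts

variable {E : Type*} [NormedAddCommGroup E] [NormedSpace ℝ E]
  {M : Type*} [TopologicalSpace M] [ChartedSpace E M] [IsManifold 𝓘(ℝ, E) ∞ M]

variable (E) in
/-- The derivative of a chart, as a map of the model space. -/
def chartDeriv (x₀ x : M) : E →L[ℝ] E := mfderiv 𝓘(ℝ, E) 𝓘(ℝ, E) (extChartAt 𝓘(ℝ, E) x₀) x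

variable (E) in
/-- The derivative of the inverse of a chart, as a map of the model space. -/
def chartSymmDeriv (x₀ : M) (y : E) : E →L[ℝ] E :=
  mfderiv 𝓘(ℝ, E) 𝓘(ℝ, E) (extChartAt 𝓘(ℝ, E) x₀).symm y

theorem hasMFDerivAt_extChartAt {x₀ x : M} (hx : x ∈ (extChartAt 𝓘(ℝ, E) x₀).source) :
    HasMFDerivAt 𝓘(ℝ, E) 𝓘(ℝ, E) (extChartAt 𝓘(ℝ, E) x₀) x (chartDeriv E x₀ x) := by
  have : IsManifold 𝓘(ℝ, E) 1 M := .of_le (n := ∞) (by simp)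
  rw [extChartAt_source] at hx
  exact (mdifferentiableAt_extChartAt hx).hasMFDerivAt

theorem hasMFDerivAt_extChartAt_symm {x₀ : M} {y : E} (hy : y ∈ (extChartAt 𝓘(ℝ, E) x₀).target) :
    HasMFDerivAt 𝓘(ℝ, E) 𝓘(ℝ, E) (extChartAt 𝓘(ℝ, E) x₀).symm y (chartSymmDeriv E x₀ y) := by
  have : IsManifold 𝓘(ℝ, E) 1 M := .of_le (n := ∞) (by simp)
  have h := mdifferentiableWithinAt_extChartAt_symm hy
  rw [modelWithCornersSelf_coe, Set.range_id, mdifferentiableWithinAt_univ] at h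
  exact h.hasMFDerivAt

theorem chartSymmDeriv_comp_chartDeriv {x₀ x : M} (hx : x ∈ (extChartAt 𝓘(ℝ, E) x₀).source) :
    (chartSymmDeriv E x₀ (extChartAt 𝓘(ℝ, E) x₀ x)).comp (chartDeriv E x₀ x) = .id ℝ E := by
  have h := (hasMFDerivAt_extChartAt_symm ((extChartAt 𝓘(ℝ, E) x₀).map_source hx)).comp x
    (hasMFDerivAt_extChartAt hx)
  refine hasMFDerivAt_unique h ((hasMFDerivAt_id x).congr_of_eventuallyEq ?_)
  filter_upwards [extChartAt_source_mem_nhds' (I := 𝓘(ℝ, E)) hx] with z hz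
    using (extChartAt 𝓘(ℝ, E) x₀).left_inv hz

/-- A form on `M` as a function with values in the covectors of the model space. -/
def Form.coords {k : ℕ} (α : Form E M k) : M → E [⋀^Fin k]→L[ℝ] ℝ := fun x => α x

omit [IsManifold 𝓘(ℝ, E) ∞ M] in
theorem chartRep_eq {k : ℕ} (α : Form E M k) (x₀ : M) (y : E) :
    chartRep α x₀ y = (α.coords ((extChartAt 𝓘(ℝ, E) x₀).symm y)).compContinuousLinearMap
      (chartSymmDeriv E x₀ y) := rfl

theorem coords_eq_chartRep {k : ℕ} (α : Form E M k) {x₀ x : M}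
    (hx : x ∈ (extChartAt 𝓘(ℝ, E) x₀).source) :
    α.coords x = (chartRep α x₀ (extChartAt 𝓘(ℝ, E) x₀ x)).compContinuousLinearMap
      (chartDeriv E x₀ x) := by
  rw [chartRep_eq, (extChartAt 𝓘(ℝ, E) x₀).left_inv hx]
  have h := chartSymmDeriv_comp_chartDeriv hx
  ext v
  simp only [ContinuousAlternatingMap.compContinuousLinearMap_apply, Function.comp_def]
  congr 1
  ext i
  exact (DFunLike.congr_fun h (v i)).symm

/-- The exterior derivative may be computed in any chart. -/
theorem chartRep_extD {k : ℕ} {α : Form E M k} (hα : IsSmoothForm α) {x₀ : M} {y : E}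
    (hy : y ∈ (extChartAt 𝓘(ℝ, E) x₀).target) :
    chartRep (extD α) x₀ y = extDeriv (chartRep α x₀) y := by
  set x := (extChartAt 𝓘(ℝ, E) x₀).symm y with hx
  -- `extD` at `x` uses the chart at `x`, not the one at `x₀`. The two expressions of `α` differ by
  -- pullback along the transition map `τ`, with which the exterior derivative commutes.
  set τ : E → E := extChartAt 𝓘(ℝ, E) x ∘ (extChartAt 𝓘(ℝ, E) x₀).symm with hτ
  have hO : IsOpen ((extChartAt 𝓘(ℝ, E) x₀).target ∩
      (extChartAt 𝓘(ℝ, E) x₀).symm ⁻¹' (extChartAt 𝓘(ℝ, E) x).source) :=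
    (contMDiffOn_extChartAt_symm (n := ∞) (I := 𝓘(ℝ, E)) x₀).continuousOn.isOpen_inter_preimage
      (isOpen_extChartAt_target x₀) (isOpen_extChartAt_source x)
  set O := (extChartAt 𝓘(ℝ, E) x₀).target ∩
      (extChartAt 𝓘(ℝ, E) x₀).symm ⁻¹' (extChartAt 𝓘(ℝ, E) x).source
  have hyO : y ∈ O := ⟨hy, mem_extChartAt_source x⟩
  have hτd : ∀ z ∈ O, HasFDerivAt τ
      ((chartDeriv E x ((extChartAt 𝓘(ℝ, E) x₀).symm z)).comp (chartSymmDeriv E x₀ z)) z :=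
    fun z hz => hasMFDerivAt_iff_hasFDerivAt.1
      ((hasMFDerivAt_extChartAt hz.2).comp z (hasMFDerivAt_extChartAt_symm hz.1))
  have hτC : ContDiffAt ℝ ∞ τ y := by
    have h1 : ContMDiffAt 𝓘(ℝ, E) 𝓘(ℝ, E) ∞ (extChartAt 𝓘(ℝ, E) x₀).symm y :=
      (contMDiffOn_extChartAt_symm x₀).contMDiffAt ((isOpen_extChartAt_target x₀).mem_nhds hy)
    have h2 : ContMDiffAt 𝓘(ℝ, E) 𝓘(ℝ, E) ∞ (extChartAt 𝓘(ℝ, E) x)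
      ((extChartAt 𝓘(ℝ, E) x₀).symm y) := contMDiffAt_extChartAt
    exact (h2.comp y h1).contDiffAt
  have hrep : chartRep α x₀ =ᶠ[𝓝 y] fun z =>
      (chartRep α x (τ z)).compContinuousLinearMap (fderiv ℝ τ z) := by
    filter_upwards [hO.mem_nhds hyO] with z hz
    rw [(hτd z hz).fderiv, chartRep_eq, coords_eq_chartRep α hz.2]
    rfl
  have hdiff : DifferentiableAt ℝ (chartRep α x) (τ y) :=
    ((hα x).contDiffAt ((isOpen_extChartAt_target x).mem_nhds
      (mem_extChartAt_target x))).differentiableAt (by simp)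
  rw [hrep.extDeriv_eq, extDeriv_pullback hdiff hτC
    (by simpa using WithTop.coe_le_coe.2 (le_top : (2 : ℕ∞) ≤ ⊤)), (hτd y hyO).fderiv]
  rfl

/-- A vector field in the chart at `x₀`. -/
def fieldRep (X : VField E M) (x₀ : M) (y : E) : E :=
  chartDeriv E x₀ ((extChartAt 𝓘(ℝ, E) x₀).symm y) (X ((extChartAt 𝓘(ℝ, E) x₀).symm y))

theorem chartSymmDeriv_fieldRep (X : VField E M) {x₀ : M} {y : E}
    (hy : y ∈ (extChartAt 𝓘(ℝ, E) x₀).target) :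
    chartSymmDeriv E x₀ y (fieldRep X x₀ y) = X ((extChartAt 𝓘(ℝ, E) x₀).symm y) := by
  have h := chartSymmDeriv_comp_chartDeriv ((extChartAt 𝓘(ℝ, E) x₀).map_target hy)
  rw [(extChartAt 𝓘(ℝ, E) x₀).right_inv hy] at h
  exact DFunLike.congr_fun h _

/-- The trivialization of the tangent bundle at `x₀` acts on fibres as the derivative of the chart,
so `fieldRep` is the fibre component of a smooth section. -/
theorem contDiffOn_fieldRep {X : VField E M}
    (hX : ContMDiff 𝓘(ℝ, E) 𝓘(ℝ, E).tangent ∞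
      (fun x => (⟨x, X x⟩ : TangentBundle 𝓘(ℝ, E) M))) (x₀ : M) :
    ContDiffOn ℝ ∞ (fieldRep X x₀) (extChartAt 𝓘(ℝ, E) x₀).target := by
  have h1 : IsManifold 𝓘(ℝ, E) 1 M := .of_le (n := ∞) (by simp)
  set T := trivializationAt E (TangentSpace 𝓘(ℝ, E) : M → Type _) x₀
  have h2 := (T.contMDiffOn_section_baseSet_iff (IB := 𝓘(ℝ, E)) (n := ∞) (s := X)).1
    hX.contMDiffOn
  have h3 := h2.comp (contMDiffOn_extChartAt_symm (n := ∞) (I := 𝓘(ℝ, E)) x₀)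
    (fun y hy => by
      have := (extChartAt 𝓘(ℝ, E) x₀).map_target hy
      rw [extChartAt_source] at this
      exact this)
  refine h3.contDiffOn.congr fun y hy => ?_
  have h4 := (extChartAt 𝓘(ℝ, E) x₀).map_target hy
  rw [extChartAt_source] at h4
  have h5 := TangentBundle.continuousLinearMapAt_trivializationAt (𝕜 := ℝ) (I := 𝓘(ℝ, E)) h4
  have h6 : fieldRep X x₀ y = T.continuousLinearMapAt ℝ ((extChartAt 𝓘(ℝ, E) x₀).symm y)
    (X ((extChartAt 𝓘(ℝ, E) x₀).symm y)) := by rw [h5]; rfl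
  rw [h6, Bundle.Trivialization.continuousLinearMapAt_apply_of_mem]
  · rfl
  · exact h4

end Charts

/-! ### Local flows on the manifold. -/

section LocalFlowManifold

variable {E : Type*} [NormedAddCommGroup E] [NormedSpace ℝ E]
  {M : Type*} [TopologicalSpace M] [ChartedSpace E M] [IsManifold 𝓘(ℝ, E) ∞ M]

/-- The conformal Hamilton equation in a chart. -/
theorem IsConformallyHamiltonian.equation_chart {Ω : Form E M 2} {θ : Form E M 1} {c : ℝ}
    {F : M → ℝ} {X : VField E M} (hX : IsConformallyHamiltonian Ω θ c F X) {x₀ : M} {y : E}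
    (hy : y ∈ (extChartAt 𝓘(ℝ, E) x₀).target) (w : E) :
    chartRep Ω x₀ y ![fieldRep X x₀ y, w] + c * chartRep θ x₀ y ![w] =
      fderiv ℝ (F ∘ (extChartAt 𝓘(ℝ, E) x₀).symm) y w := by
  set x := (extChartAt 𝓘(ℝ, E) x₀).symm y
  have h := hX.equation x (chartSymmDeriv E x₀ y w)
  let dF : E →L[ℝ] ℝ := mfderiv 𝓘(ℝ, E) 𝓘(ℝ, ℝ) F x
  have hF : HasMFDerivAt 𝓘(ℝ, E) 𝓘(ℝ, ℝ) F x dF :=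
    (hX.smooth_hamiltonian.mdifferentiable (by simp) x).hasMFDerivAt
  have hd : HasFDerivAt (F ∘ (extChartAt 𝓘(ℝ, E) x₀).symm) (dF.comp (chartSymmDeriv E x₀ y)) y :=
    hasMFDerivAt_iff_hasFDerivAt.1 (hF.comp y (hasMFDerivAt_extChartAt_symm hy))
  have h1 : chartRep Ω x₀ y ![fieldRep X x₀ y, w] =
      Ω.coords x ![X x, chartSymmDeriv E x₀ y w] := by
    rw [chartRep_eq, ContinuousAlternatingMap.compContinuousLinearMap_apply]
    congr 1
    ext i
    fin_cases i
    · exact chartSymmDeriv_fieldRep X hy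
    · rfl
  have h2 : chartRep θ x₀ y ![w] = θ.coords x ![chartSymmDeriv E x₀ y w] := by
    rw [chartRep_eq, ContinuousAlternatingMap.compContinuousLinearMap_apply]
    congr 1
    ext i
    fin_cases i
    rfl
  rw [h1, h2, hd.fderiv]
  exact h

theorem lieDeriv_chartRep {Ω : Form E M 2} {θ : Form E M 1} (hΩ : IsExactSymplectic Ω θ) {c : ℝ}
    {F : M → ℝ} {X : VField E M} (hX : IsConformallyHamiltonian Ω θ c F X) {x₀ : M} {p : E}
    (hp : p ∈ (extChartAt 𝓘(ℝ, E) x₀).target) (a b : E) :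
    fderiv ℝ (chartRep Ω x₀) p (fieldRep X x₀ p) ![a, b] +
      chartRep Ω x₀ p ![fderiv ℝ (fieldRep X x₀) p a, b] +
      chartRep Ω x₀ p ![a, fderiv ℝ (fieldRep X x₀) p b] = c * chartRep Ω x₀ p ![a, b] := by
  have hnhds := (isOpen_extChartAt_target (I := 𝓘(ℝ, E)) x₀).mem_nhds hp
  have hn : (∞ : WithTop ℕ∞) ≠ 0 := by simp
  have h2 : (2 : WithTop ℕ∞) ≤ ∞ := by simpa using WithTop.coe_le_coe.2 (le_top : (2 : ℕ∞) ≤ ⊤)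
  have hF : ContDiffAt ℝ 2 (F ∘ (extChartAt 𝓘(ℝ, E) x₀).symm) p := by
    have h : ContMDiffAt 𝓘(ℝ, E) 𝓘(ℝ, E) ∞ (extChartAt 𝓘(ℝ, E) x₀).symm p :=
      (contMDiffOn_extChartAt_symm x₀).contMDiffAt hnhds
    exact ((hX.smooth_hamiltonian.contMDiffAt.comp p h).contDiffAt).of_le h2
  refine lieDeriv_eq_of_conformallyHamiltonian (θ := chartRep θ x₀)
    (F := F ∘ (extChartAt 𝓘(ℝ, E) x₀).symm)
    (((hΩ.symplectic.smooth x₀).contDiffAt hnhds).differentiableAt hn)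
    (((hΩ.smooth_primitive x₀).contDiffAt hnhds).differentiableAt hn)
    (((contDiffOn_fieldRep hX.smooth_field x₀).contDiffAt hnhds).differentiableAt hn) hF
    (Filter.mem_of_superset hnhds fun q hq w => hX.equation_chart hq w) ?_ ?_ a b
  · rw [← chartRep_extD hΩ.symplectic.smooth hp, hΩ.symplectic.closed]
    ext v
    rfl
  · rw [← chartRep_extD hΩ.smooth_primitive hp, hΩ.eq_neg_extD]
    ext v
    rfl

/-- Near every point there is a smooth local flow, which multiplies `Ω` by `e^{cs}`. -/
theorem exists_localFlow [FiniteDimensional ℝ E] {Ω : Form E M 2} {θ : Form E M 1}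
    (hΩ : IsExactSymplectic Ω θ) {c : ℝ} {F : M → ℝ} {X : VField E M}
    (hX : IsConformallyHamiltonian Ω θ c F X) (x₀ : M) :
    ∃ ε > 0, ∃ V : Set M, IsOpen V ∧ x₀ ∈ V ∧ ∃ Φ : ℝ → M → M,
      (∀ x ∈ V, Φ 0 x = x ∧ IsMIntegralCurveOn (fun s => Φ s x) X (Set.Ioo (-ε) ε)) ∧
      ∀ s ∈ Set.Ioo (-ε) ε, ContMDiffOn 𝓘(ℝ, E) 𝓘(ℝ, E) ∞ (Φ s) V ∧
        ∀ x ∈ V, pullback (Φ s) Ω x = Real.exp (c * s) • Ω x := by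
  have hopen := isOpen_extChartAt_target (I := 𝓘(ℝ, E)) x₀
  have hn : (∞ : WithTop ℕ∞) ≠ 0 := by simp
  have hfield := contDiffOn_fieldRep hX.smooth_field x₀
  obtain ⟨ε, hε, V, hV, hxV, φ, hφ, hφ0, hφd⟩ := exists_contDiffOn_localFlow hopen hfield
    (mem_extChartAt_target x₀)
  have hVopen : IsOpen ((extChartAt 𝓘(ℝ, E) x₀).source ∩ extChartAt 𝓘(ℝ, E) x₀ ⁻¹' V) :=
    (continuousOn_extChartAt x₀).isOpen_inter_preimage (isOpen_extChartAt_source x₀) hV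
  refine ⟨ε, hε, (extChartAt 𝓘(ℝ, E) x₀).source ∩ extChartAt 𝓘(ℝ, E) x₀ ⁻¹' V, hVopen,
    ⟨mem_extChartAt_source x₀, hxV⟩,
    fun s x => (extChartAt 𝓘(ℝ, E) x₀).symm (φ (s, extChartAt 𝓘(ℝ, E) x₀ x)),
    fun x hx => ⟨?_, fun s hs => ?_⟩, fun s hs => ?_⟩
  · change (extChartAt 𝓘(ℝ, E) x₀).symm (φ (0, extChartAt 𝓘(ℝ, E) x₀ x)) = x
    rw [hφ0 _ hx.2, (extChartAt 𝓘(ℝ, E) x₀).left_inv hx.1]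
  · obtain ⟨h1, h2⟩ := hφd s hs _ hx.2
    have h3 := (hasMFDerivAt_extChartAt_symm h1).comp s h2.hasFDerivAt.hasMFDerivAt
    refine (h3.congr_mfderiv (ContinuousLinearMap.ext fun (r : ℝ) => ?_)).hasMFDerivWithinAt
    exact (map_smul (chartSymmDeriv E x₀ _) (r : ℝ) _).trans
      (congrArg (fun v : E => r • v) (chartSymmDeriv_fieldRep X h1))
  · have hspace : ∀ y ∈ V, ContDiffAt ℝ ∞ (fun y => φ (s, y)) y := fun y hy =>
      (hφ.contDiffAt ((isOpen_Ioo.prod hV).mem_nhds ⟨hs, hy⟩)).comp y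
        (contDiff_const.prodMk contDiff_id).contDiffAt
    have hsm : ContMDiffOn 𝓘(ℝ, E) 𝓘(ℝ, E) ∞
        (fun x => (extChartAt 𝓘(ℝ, E) x₀).symm (φ (s, extChartAt 𝓘(ℝ, E) x₀ x)))
        ((extChartAt 𝓘(ℝ, E) x₀).source ∩ extChartAt 𝓘(ℝ, E) x₀ ⁻¹' V) := by
      intro x hx
      have h1 : ContMDiffAt 𝓘(ℝ, E) 𝓘(ℝ, E) ∞ (extChartAt 𝓘(ℝ, E) x₀) x :=
        contMDiffAt_extChartAt' (by simpa using hx.1)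
      have h2 := (hspace _ hx.2).contMDiffAt
      have h3 : ContMDiffAt 𝓘(ℝ, E) 𝓘(ℝ, E) ∞ (extChartAt 𝓘(ℝ, E) x₀).symm
          (φ (s, extChartAt 𝓘(ℝ, E) x₀ x)) :=
        (contMDiffOn_extChartAt_symm x₀).contMDiffAt (hopen.mem_nhds (hφd s hs _ hx.2).1)
      exact (h3.comp x (h2.comp x h1)).contMDiffWithinAt
    refine ⟨hsm, fun x hx => ?_⟩
    have hy := (hφd s hs _ hx.2).1
    have hd := (hasMFDerivAt_extChartAt_symm hy).comp x
      ((((hspace _ hx.2).differentiableAt hn).hasFDerivAt.hasMFDerivAt).comp x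
        (hasMFDerivAt_extChartAt hx.1))
    have hmain := compContinuousLinearMap_localFlow (c := c) hV
      (fun p hp => ((hΩ.symplectic.smooth x₀).contDiffAt (hopen.mem_nhds hp)).differentiableAt hn)
      (fun p hp => (hfield.contDiffAt (hopen.mem_nhds hp)).differentiableAt hn)
      (fun p hp a b => lieDeriv_chartRep hΩ hX hp a b) hφ hφ0 hφd hs hx.2
    -- The chain rule for chart, `φ (s, ·)` and inverse chart; the factor of the inverse chart is
    -- absorbed in `chartRep`.
    have hpull : pullback (fun x => (extChartAt 𝓘(ℝ, E) x₀).symm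
        (φ (s, extChartAt 𝓘(ℝ, E) x₀ x))) Ω x =
        ((chartRep Ω x₀ (φ (s, extChartAt 𝓘(ℝ, E) x₀ x))).compContinuousLinearMap
          (fderiv ℝ (fun y => φ (s, y)) (extChartAt 𝓘(ℝ, E) x₀ x))).compContinuousLinearMap
          (chartDeriv E x₀ x) :=
      congrArg (fun L : E →L[ℝ] E => (Ω.coords ((extChartAt 𝓘(ℝ, E) x₀).symm
        (φ (s, extChartAt 𝓘(ℝ, E) x₀ x)))).compContinuousLinearMap L) (HasMFDerivAt.mfderiv hd)
    rw [hpull, hmain]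
    refine ContinuousAlternatingMap.ext fun v => ?_
    exact (congrArg (Real.exp (c * s) * ·)
      (DFunLike.congr_fun (coords_eq_chartRep Ω hx.1) v)).symm

end LocalFlowManifold

/-! ### Uniqueness and the local group law of the flow. -/

section Flow

variable {E : Type*} [NormedAddCommGroup E] [NormedSpace ℝ E]
  {M : Type*} [TopologicalSpace M] [T2Space M] [ChartedSpace E M] [IsManifold 𝓘(ℝ, E) ∞ M]
  {X : VField E M}

/-- Integral curves agree on the intersection of their intervals, `M` being Hausdorff, so the choice
made in `flow` is immaterial. -/
theorem flow_eq (hX : ContMDiff 𝓘(ℝ, E) 𝓘(ℝ, E).tangent ∞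
      (fun x => (⟨x, X x⟩ : TangentBundle 𝓘(ℝ, E) M)))
    {γ : ℝ → M} {a b t : ℝ} (h0 : 0 ∈ Set.Ioo a b) (ht : t ∈ Set.Ioo a b)
    (hγ : IsMIntegralCurveOn γ X (Set.Ioo a b)) : flow X t (γ 0) = γ t := by
  have : IsManifold 𝓘(ℝ, E) 1 M := .of_le (n := ∞) (by simp)
  have h : FlowDefinedAt X t (γ 0) := ⟨γ, a, b, h0, ht, rfl, hγ⟩
  rw [flow, dif_pos h]
  obtain ⟨a', b', h0', ht', h00, hγ'⟩ := h.choose_spec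
  have hX1 := hX.of_le (m := 1) (by simp)
  refine isMIntegralCurveOn_Ioo_eqOn_of_contMDiff_boundaryless (t₀ := 0)
    (a := max a' a) (b := min b' b) ⟨max_lt h0'.1 h0.1, lt_min h0'.2 h0.2⟩ hX1
    (hγ'.mono (Set.Ioo_subset_Ioo (le_max_left ..) (min_le_left ..)))
    (hγ.mono (Set.Ioo_subset_Ioo (le_max_right ..) (min_le_right ..))) h00
    ⟨max_lt ht'.1 ht.1, lt_min ht'.2 ht.2⟩

/-- The curve `δ`, shifted by `s`, is glued to the integral curve of `x`; the union of the two
intervals contains both `0` and `s + r`. -/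
theorem flow_add (hX : ContMDiff 𝓘(ℝ, E) 𝓘(ℝ, E).tangent ∞
      (fun x => (⟨x, X x⟩ : TangentBundle 𝓘(ℝ, E) M)))
    {s r ε : ℝ} {x : M} (hx : x ∈ flowDomain X s) {δ : ℝ → M} (h0 : δ 0 = flow X s x)
    (hδ : IsMIntegralCurveOn δ X (Set.Ioo (-ε) ε)) (hr : r ∈ Set.Ioo (-ε) ε) :
    x ∈ flowDomain X (s + r) ∧ flow X (s + r) x = δ r := by
  have : IsManifold 𝓘(ℝ, E) 1 M := .of_le (n := ∞) (by simp)
  obtain ⟨γ, a, b, h0ab, hsab, rfl, hγ⟩ := hx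
  have hX1 := hX.of_le (m := 1) (by simp)
  rw [flow_eq hX h0ab hsab hγ] at h0
  have hε : 0 < ε := by linarith [hr.1, hr.2]
  have hδs : IsMIntegralCurveOn (δ ∘ (· - s)) X (Set.Ioo (s - ε) (s + ε)) :=
    (isMIntegralCurveOn_comp_sub (dt := s).2 hδ).mono fun t ht => ⟨by linarith [ht.1], by linarith [ht.2]⟩
  have hs : s ∈ Set.Ioo a b ∩ Set.Ioo (s - ε) (s + ε) := ⟨hsab, by simpa, by simpa⟩
  have hagree : γ s = (δ ∘ (· - s)) s := by simp [h0]
  have hglue := isMIntegralCurveOn_piecewise hX1 hγ hδs hs hagree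
  have heq := eqOn_piecewise_of_isMIntegralCurveOn_Ioo hX1 hγ hδs hs hagree
  have hunion : Set.Ioo a b ∪ Set.Ioo (s - ε) (s + ε) =
      Set.Ioo (min a (s - ε)) (max b (s + ε)) :=
    Set.Ioo_union_Ioo' (by linarith [hsab.2]) (by linarith [hsab.1])
  have hmem : s + r ∈ Set.Ioo (s - ε) (s + ε) := ⟨by linarith [hr.1], by linarith [hr.2]⟩
  rw [hunion] at hglue
  set β := Set.piecewise (Set.Ioo a b) γ (δ ∘ (· - s))
  have hβ0 : β 0 = γ 0 := Set.piecewise_eq_of_mem _ _ _ h0ab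
  have h0' : (0 : ℝ) ∈ Set.Ioo (min a (s - ε)) (max b (s + ε)) := hunion ▸ .inl h0ab
  have hsr : s + r ∈ Set.Ioo (min a (s - ε)) (max b (s + ε)) := hunion ▸ .inr hmem
  refine ⟨⟨β, _, _, h0', hsr, hβ0, hglue⟩, ?_⟩
  rw [← hβ0, flow_eq hX h0' hsr hglue, heq hmem]
  simp

end Flow

/-! ### Propagation along an integral curve, and the volume form. -/

section Main

variable {E : Type*} [NormedAddCommGroup E] [NormedSpace ℝ E] [FiniteDimensional ℝ E]
  {M : Type*} [TopologicalSpace M] [T2Space M] [ChartedSpace E M] [IsManifold 𝓘(ℝ, E) ∞ M]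

omit [FiniteDimensional ℝ E] [T2Space M] [IsManifold 𝓘(ℝ, E) ∞ M] in
theorem pullback_comp {k : ℕ} (α : Form E M k) {f g : M → M} {x : M}
    (hg : MDifferentiableAt 𝓘(ℝ, E) 𝓘(ℝ, E) g (f x))
    (hf : MDifferentiableAt 𝓘(ℝ, E) 𝓘(ℝ, E) f x) :
    pullback (g ∘ f) α x =
      (pullback g α (f x)).compContinuousLinearMap (mfderiv 𝓘(ℝ, E) 𝓘(ℝ, E) f x) := by
  rw [pullback, mfderiv_comp x hg hf]
  rfl

omit [FiniteDimensional ℝ E] [T2Space M] [IsManifold 𝓘(ℝ, E) ∞ M] in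
theorem pullback_congr {k : ℕ} (α : Form E M k) {f g : M → M} {x : M} (h : f =ᶠ[𝓝 x] g) :
    pullback f α x = pullback g α x := by
  have h0 := h.self_of_nhds
  ext v
  have h1 : ∀ w, mfderiv 𝓘(ℝ, E) 𝓘(ℝ, E) f x w = mfderiv 𝓘(ℝ, E) 𝓘(ℝ, E) g x w := fun w => by
    rw [h.mfderiv_eq]
    rfl
  change α.coords (f x) (fun i => mfderiv 𝓘(ℝ, E) 𝓘(ℝ, E) f x (v i)) =
    α.coords (g x) (fun i => mfderiv 𝓘(ℝ, E) 𝓘(ℝ, E) g x (v i))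
  rw [h0]
  exact congrArg _ (funext fun i => h1 (v i))

variable {Ω : Form E M 2} {θ : Form E M 1} {c : ℝ} {F : M → ℝ} {X : VField E M}

/-- The time-`s` map is defined, smooth and conformally symplectic near `x`. -/
def IsConformalNear (Ω : Form E M 2) (X : VField E M) (c s : ℝ) (x : M) : Prop :=
  ∃ W : Set M, IsOpen W ∧ x ∈ W ∧ W ⊆ flowDomain X s ∧
    ContMDiffOn 𝓘(ℝ, E) 𝓘(ℝ, E) ∞ (flow X s) W ∧
    ∀ y ∈ W, pullback (flow X s) Ω y = Real.exp (c * s) • Ω y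

omit [FiniteDimensional ℝ E] in
-- On `W ∩ flow X s ⁻¹' V` the time-`(s + r)` map is `Φ r ∘ flow X s`, and the conformal factors
-- multiply.
theorem IsConformalNear.add (hX : ContMDiff 𝓘(ℝ, E) 𝓘(ℝ, E).tangent ∞
      (fun x => (⟨x, X x⟩ : TangentBundle 𝓘(ℝ, E) M)))
    {s r ε : ℝ} {x : M} {V : Set M} {Φ : ℝ → M → M} (h : IsConformalNear Ω X c s x)
    (hV : IsOpen V) (hxV : flow X s x ∈ V)
    (hΦ : ∀ x ∈ V, Φ 0 x = x ∧ IsMIntegralCurveOn (fun s => Φ s x) X (Set.Ioo (-ε) ε))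
    (hr : r ∈ Set.Ioo (-ε) ε) (hsm : ContMDiffOn 𝓘(ℝ, E) 𝓘(ℝ, E) ∞ (Φ r) V)
    (hpull : ∀ x ∈ V, pullback (Φ r) Ω x = Real.exp (c * r) • Ω x) :
    IsConformalNear Ω X c (s + r) x := by
  obtain ⟨W, hW, hxW, hWD, hWsm, hWpull⟩ := h
  have hW' : IsOpen (W ∩ flow X s ⁻¹' V) := hWsm.continuousOn.isOpen_inter_preimage hW hV
  have hflow : ∀ y ∈ W ∩ flow X s ⁻¹' V,
      y ∈ flowDomain X (s + r) ∧ flow X (s + r) y = Φ r (flow X s y) := fun y hy =>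
    flow_add hX (hWD hy.1) (hΦ _ hy.2).1 (hΦ _ hy.2).2 hr
  refine ⟨W ∩ flow X s ⁻¹' V, hW', ⟨hxW, hxV⟩, fun y hy => (hflow y hy).1, ?_, fun y hy => ?_⟩
  · exact (hsm.comp (hWsm.mono Set.inter_subset_left) fun y hy => hy.2).congr
      fun y hy => (hflow y hy).2
  · have heq : flow X (s + r) =ᶠ[𝓝 y] Φ r ∘ flow X s := by
      filter_upwards [hW'.mem_nhds hy] with z hz using (hflow z hz).2
    have hd1 : MDifferentiableAt 𝓘(ℝ, E) 𝓘(ℝ, E) (Φ r) (flow X s y) :=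
      (hsm.contMDiffAt (hV.mem_nhds hy.2)).mdifferentiableAt (by simp)
    have hd2 : MDifferentiableAt 𝓘(ℝ, E) 𝓘(ℝ, E) (flow X s) y :=
      (hWsm.contMDiffAt (hW.mem_nhds hy.1)).mdifferentiableAt (by simp)
    rw [pullback_congr Ω heq, pullback_comp Ω hd1 hd2, hpull _ hy.2]
    refine ContinuousAlternatingMap.ext fun v => ?_
    have hv : pullback (flow X s) Ω y v = Real.exp (c * s) * Ω y v :=
      DFunLike.congr_fun (hWpull y hy.1) v
    change Real.exp (c * r) * pullback (flow X s) Ω y v = Real.exp (c * (s + r)) * Ω y v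
    rw [hv, mul_add, Real.exp_add]
    ring

theorem isConformalNear_zero (hX : ContMDiff 𝓘(ℝ, E) 𝓘(ℝ, E).tangent ∞
      (fun x => (⟨x, X x⟩ : TangentBundle 𝓘(ℝ, E) M))) (x : M) :
    IsConformalNear Ω X c 0 x := by
  have : IsManifold 𝓘(ℝ, E) 1 M := .of_le (n := ∞) (by simp)
  have h : ∀ y : M, y ∈ flowDomain X 0 ∧ flow X 0 y = y := by
    intro y
    obtain ⟨γ, h0, hγ⟩ := exists_isMIntegralCurveAt_of_contMDiffAt_boundaryless (t₀ := 0)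
      ((hX.of_le (m := 1) (by simp)).contMDiffAt (x := y))
    obtain ⟨ε, hε, hγε⟩ := isMIntegralCurveAt_iff'.1 hγ
    rw [Real.ball_eq_Ioo, zero_sub, zero_add] at hγε
    have h0ε : (0 : ℝ) ∈ Set.Ioo (-ε) ε := ⟨by linarith, hε⟩
    refine ⟨⟨γ, _, _, h0ε, h0ε, h0, hγε⟩, ?_⟩
    have := flow_eq hX h0ε h0ε hγε
    rwa [h0] at this
  have hid : flow X 0 = id := funext fun y => (h y).2
  refine ⟨Set.univ, isOpen_univ, trivial, fun y _ => (h y).1, ?_, fun y _ => ?_⟩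
  · rw [hid]
    exact contMDiffOn_id
  · rw [pullback_congr Ω (Filter.EventuallyEq.of_eq hid), pullback, mfderiv_id, mul_zero,
      Real.exp_zero, one_smul]
    rfl

/-- The property is locally constant in time on the connected interval `Ioo a b`, and true at time
`0`. -/
theorem isConformalNear_of_mem_flowDomain (hΩ : IsExactSymplectic Ω θ)
    (hX : IsConformallyHamiltonian Ω θ c F X) {t : ℝ} {x : M} (hx : x ∈ flowDomain X t) :
    IsConformalNear Ω X c t x := by
  obtain ⟨γ, a, b, h0, ht, rfl, hγ⟩ := hx
  have hflow : ∀ s ∈ Set.Ioo a b, flow X s (γ 0) = γ s := fun s hs =>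
    flow_eq hX.smooth_field h0 hs hγ
  have key := isPreconnected_Ioo.induction₂ (s := Set.Ioo a b)
    (fun s s' => IsConformalNear Ω X c s (γ 0) ↔ IsConformalNear Ω X c s' (γ 0)) ?_
    (fun _ _ _ _ _ _ h h' => h.trans h') (fun _ _ _ _ h => h.symm) h0 ht
  · exact key.1 (isConformalNear_zero hX.smooth_field _)
  intro s hs
  obtain ⟨ε, hε, V, hV, hxV, Φ, hΦ, hΦs⟩ := exists_localFlow hΩ hX (γ s)
  have hcont := hγ.continuousWithinAt hs
  filter_upwards [hcont (hV.mem_nhds hxV), self_mem_nhdsWithin,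
    mem_nhdsWithin_of_mem_nhds (Metric.ball_mem_nhds s hε)] with s' hs'V hs' hs'ε
  rw [Metric.mem_ball, Real.dist_eq, abs_lt] at hs'ε
  -- One local flow around `γ s` serves every nearby time: `γ s'` also lies in `V`, so it carries
  -- the property from `s` to `s'` and back.
  have step : ∀ p ∈ Set.Ioo a b, ∀ q, γ p ∈ V → q - p ∈ Set.Ioo (-ε) ε →
      IsConformalNear Ω X c p (γ 0) → IsConformalNear Ω X c q (γ 0) := by
    intro p hp q hpV hqp h
    have := h.add hX.smooth_field hV (by rwa [hflow p hp]) hΦ hqp (hΦs _ hqp).1 (hΦs _ hqp).2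
    rwa [add_sub_cancel] at this
  exact ⟨step s hs s' hxV hs'ε,
    step s' hs' s hs'V ⟨by linarith [hs'ε.2], by linarith [hs'ε.1]⟩⟩

omit [FiniteDimensional ℝ E] [T2Space M] [IsManifold 𝓘(ℝ, E) ∞ M] in
theorem pullback_liouvilleVolume (n : ℕ) {f : M → M} {x : M} {r : ℝ}
    (h : pullback f Ω x = r • Ω x) :
    pullback f (liouvilleVolume n Ω) x = r ^ n • liouvilleVolume n Ω x := by
  let T : E →L[ℝ] E := mfderiv 𝓘(ℝ, E) 𝓘(ℝ, E) f x
  have h' : (Ω.coords (f x)).compContinuousLinearMap T = r • Ω.coords x := h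
  have h1 : (wedgePow (Ω.coords (f x)) n).compContinuousLinearMap T =
      r ^ n • wedgePow (Ω.coords x) n := by
    rw [← wedgePow_compContinuousLinearMap, h', wedgePow_smul]
  refine ContinuousAlternatingMap.ext fun v => ?_
  exact (congrArg ((-1 : ℝ) ^ (n / 2) / (n.factorial : ℝ) * ·) (DFunLike.congr_fun h1 v)).trans
    (mul_left_comm _ _ _)

end Main

end ConfSympl

end

theorem mainTheorem9 (n : ℕ)
    {E : Type*} [NormedAddCommGroup E] [NormedSpace ℝ E] [FiniteDimensional ℝ E]
    (hE : Module.finrank ℝ E = 2 * n)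
    {M : Type*} [TopologicalSpace M] [T2Space M] [ChartedSpace E M] [IsManifold 𝓘(ℝ, E) ∞ M]
    (Ω : ConfSympl.Form E M 2) (θ : ConfSympl.Form E M 1)
    (hΩ : ConfSympl.IsExactSymplectic Ω θ)
    (c : ℝ) (F : M → ℝ) (X : ConfSympl.VField E M)
    (hX : ConfSympl.IsConformallyHamiltonian Ω θ c F X) (t : ℝ) :
    ConfSympl.IsConformallySymplecticOn Ω (ConfSympl.flow X t) (ConfSympl.flowDomain X t)
        (Real.exp (c * t)) ∧
      ∀ x ∈ ConfSympl.flowDomain X t,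
        ConfSympl.pullback (ConfSympl.flow X t) (ConfSympl.liouvilleVolume n Ω) x =
          Real.exp (n * c * t) • ConfSympl.liouvilleVolume n Ω x := by
  have hnear := fun x (hx : x ∈ ConfSympl.flowDomain X t) =>
    ConfSympl.isConformalNear_of_mem_flowDomain hΩ hX hx
  have hpull : ∀ x ∈ ConfSympl.flowDomain X t, ConfSympl.pullback (ConfSympl.flow X t) Ω x =
      Real.exp (c * t) • Ω x := fun x hx => by
    obtain ⟨W, -, hxW, -, -, h⟩ := hnear x hx
    exact h x hxW
  refine ⟨⟨isOpen_iff_mem_nhds.2 fun x hx => ?_, fun x hx => ?_, Real.exp_pos _, hpull⟩,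
    fun x hx => ?_⟩
  · obtain ⟨W, hW, hxW, hWD, -, -⟩ := hnear x hx
    exact Filter.mem_of_superset (hW.mem_nhds hxW) hWD
  · obtain ⟨W, hW, hxW, -, hsm, -⟩ := hnear x hx
    exact (hsm.contMDiffAt (hW.mem_nhds hxW)).contMDiffWithinAt
  · rw [ConfSympl.pullback_liouvilleVolume n (hpull x hx), ← Real.exp_nat_mul, ← mul_assoc]
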